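/- **Proposition (Dimensional lower bound).** For an integer $L\ge 0$ let $V_L$ be the real vector space of real signals $f:S^2\to\mathbb{R}$ band-limited at degree $L$, i.e. those of the form $f=\sum_{\ell=0}^{L}\sum_{m=-\ell}^{\ell}a_\ell^m Y_\ell^m$ with $a_\ell^m\in\mathbb{C}$, where $Y_\ell^m$ are the standard spherical harmonics. Let $\mathrm{SO}(3)$ act on signals by $(g\cdot f)(x)=f(g^{-1}x)$. Then $\dim_{\mathbb{R}}V_L=(L+1)^2$, and the following holds. Call a map $\Phi:V_L\to\mathbb{R}^k$ a *complete invariant* if it is smooth ($C^\infty$) or polynomial, satisfies $\Phi(g\cdot f)=\Phi(f)$ for all $g\in\mathrm{SO}(3)$ and $f\in V_L$, and separates orbits on some Zariski-open dense set $U\subseteq V_L$: whenever $f,f'\in U$ and $\Phi(f)=\Phi(f')$, there is $g\in\mathrm{SO}(3)$ with $f'=g\cdot f$. If $\Phi:V_L\to\mathbb{R}^k$ is a complete invariant, then $$k\ \ge\ (L+1)^2-3 .$$ Hence a complete invariant needs $\Omega(L^2)$ components: there are constants $c>0$ and $L_0$ such that for all $L\ge L_0$ every complete invariant $\Phi:V_L\to\mathbb{R}^k$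 has $k\ge cL^2$. -/

import Mathlib

noncomputable section

/-- The unit sphere `S²` in Euclidean three-space. -/
abbrev S2 : Type := Metric.sphere (0 : EuclideanSpace ℝ (Fin 3)) 1

/-- The rotation group `SO(3)`. -/
abbrev SO3 : Type := Matrix.specialOrthogonalGroup (Fin 3) ℝ

/-- The Legendre polynomial `P_ℓ`, by Rodrigues' formula. -/
def legendreP (l : ℕ) : Polynomial ℝ :=
  Polynomial.C (1 / (2 ^ l * (l.factorial : ℝ))) *
    Polynomial.derivative^[l] ((Polynomial.X ^ 2 - 1) ^ l)

/-- The spherical harmonic `Y_ℓ^m` for `0 ≤ m ≤ ℓ`, in Cartesian coordinates. At the point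
`(sin θ cos φ, sin θ sin φ, cos θ)` the factor `(-1)^m P_ℓ^{(m)}(z) (x + i y)^m` is
`P_ℓ^m(cos θ) e^{i m φ}`, with `P_ℓ^m` the associated Legendre function
(Condon-Shortley phase included). -/
def sphHarmNonneg (l m : ℕ) (p : S2) : ℂ :=
  (Real.sqrt ((2 * (l : ℝ) + 1) / (4 * Real.pi) * (((l - m).factorial : ℝ) / ((l + m).factorial : ℝ))) : ℝ) *
    (-1) ^ m * (((Polynomial.derivative^[m] (legendreP l)).eval (p.1 2) : ℝ) : ℂ) *
    ((p.1 0 : ℂ) + Complex.I * (p.1 1 : ℂ)) ^ m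

/-- The spherical harmonic `Y_ℓ^m`, `-ℓ ≤ m ≤ ℓ`, with `Y_ℓ^{-m} = (-1)^m conj (Y_ℓ^m)`. -/
def sphHarm (l : ℕ) (m : ℤ) (p : S2) : ℂ :=
  if 0 ≤ m then sphHarmNonneg l m.natAbs p
  else (-1) ^ m.natAbs * (starRingEnd ℂ) (sphHarmNonneg l m.natAbs p)

/-- The real vector space of real signals on `S²` that are band-limited at degree `L`, that is,
with a spherical harmonic expansion of degree at most `L`. It carries the sup norm. -/
def bandLimited (L : ℕ) : Submodule ℝ C(S2, ℝ) where
  carrier := {f | ∃ a : ℕ → ℤ → ℂ, ∀ p : S2, (f p : ℂ) =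
    ∑ l ∈ Finset.range (L + 1), ∑ m ∈ Finset.Icc (-(l : ℤ)) (l : ℤ), a l m * sphHarm l m p}
  zero_mem' := ⟨fun _ _ => 0, fun p => by simp⟩
  add_mem' := by
    rintro f g ⟨a, ha⟩ ⟨b, hb⟩
    refine ⟨fun l m => a l m + b l m, fun p => ?_⟩
    simp only [ContinuousMap.add_apply, Complex.ofReal_add, ha p, hb p, add_mul,
      Finset.sum_add_distrib]
  smul_mem' := by
    rintro c f ⟨a, ha⟩
    refine ⟨fun l m => (c : ℂ) * a l m, fun p => ?_⟩
    simp only [ContinuousMap.smul_apply, smul_eq_mul, Complex.ofReal_mul, ha p, mul_assoc,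
      Finset.mul_sum]

/-- The action of a rotation on the sphere. -/
def rotatePoint (g : SO3) (p : S2) : S2 :=
  ⟨WithLp.toLp 2 ((g : Matrix (Fin 3) (Fin 3) ℝ).mulVec (WithLp.ofLp p.1)), by
    have hg : (g : Matrix (Fin 3) (Fin 3) ℝ).transpose * (g : Matrix (Fin 3) (Fin 3) ℝ) = 1 :=
      (Matrix.mem_orthogonalGroup_iff' (Fin 3) ℝ).1
        (Matrix.mem_specialOrthogonalGroup_iff.1 g.2).1
    have hp : ‖p.1‖ = 1 := by simp
    rw [mem_sphere_zero_iff_norm, ← sq_eq_sq₀ (norm_nonneg _) zero_le_one,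
      EuclideanSpace.real_norm_sq_eq]
    have hp2 := congrArg (· ^ 2) hp
    simp only [EuclideanSpace.real_norm_sq_eq] at hp2
    refine Eq.trans ?_ hp2
    dsimp only
    have h : ∀ v : Fin 3 → ℝ, ∑ i, v i ^ 2 = v ⬝ᵥ v := fun v => by
      simp [dotProduct, sq]
    rw [h, h, Matrix.dotProduct_mulVec, Matrix.vecMul_mulVec, hg, Matrix.vecMul_one]⟩

theorem continuous_rotatePoint (g : SO3) : Continuous (rotatePoint g) := by
  unfold rotatePoint
  refine Continuous.subtype_mk ?_ _
  refine (PiLp.continuous_toLp 2 _).comp ?_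
  exact Continuous.matrix_mulVec continuous_const
    ((PiLp.continuous_ofLp 2 _).comp continuous_subtype_val)

/-- The action of `SO(3)` on signals: `(g • f)(x) = f (g⁻¹ x)`. -/
def rotate (g : SO3) (f : C(S2, ℝ)) : C(S2, ℝ) :=
  f.comp ⟨rotatePoint g⁻¹, continuous_rotatePoint g⁻¹⟩

/-- The algebra of real polynomial functions on a real vector space: the functions generated by
the linear forms and the constants. -/
def polyFun (V : Type*) [AddCommGroup V] [Module ℝ V] : Subalgebra ℝ (V → ℝ) :=
  Algebra.adjoin ℝ (Set.range fun φ : Module.Dual ℝ V => (φ : V → ℝ))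

/-- The Zariski topology on a real vector space, generated by the non-vanishing sets of
polynomial functions. -/
abbrev zariskiTopology (V : Type*) [AddCommGroup V] [Module ℝ V] : TopologicalSpace V :=
  TopologicalSpace.generateFrom {U | ∃ p ∈ polyFun V, U = {v | p v ≠ 0}}

/-- `Φ` is invariant: it takes the same value on two signals that differ by a rotation. -/
def IsRotationInvariant {L k : ℕ} (Φ : bandLimited L → EuclideanSpace ℝ (Fin k)) : Prop :=
  ∀ (g : SO3) (f f' : bandLimited L), (f' : C(S2, ℝ)) = rotate g f → Φ f' = Φ f

/-- `Φ` separates the `SO(3)`-orbits that meet `U`: signals in `U` with the same value of `Φ`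
differ by a rotation. -/
def SeparatesOrbitsOn {L k : ℕ} (Φ : bandLimited L → EuclideanSpace ℝ (Fin k))
    (U : Set (bandLimited L)) : Prop :=
  ∀ f ∈ U, ∀ f' ∈ U, Φ f = Φ f' → ∃ g : SO3, (f' : C(S2, ℝ)) = rotate g f

/-- A smooth or polynomial complete `SO(3)`-invariant with `k` real components for real signals
of band-limit `L`. -/
structure IsCompleteInvariant (L k : ℕ) (Φ : bandLimited L → EuclideanSpace ℝ (Fin k)) :
    Prop where
  smooth_or_polynomial :
    ContDiff ℝ ((⊤ : ℕ∞) : WithTop ℕ∞) Φ ∨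
      ∀ i : Fin k, (fun f => Φ f i) ∈ polyFun (bandLimited L)
  invariant : IsRotationInvariant Φ
  separates : ∃ U : Set (bandLimited L),
    @IsOpen _ (zariskiTopology (bandLimited L)) U ∧ @Dense _ (zariskiTopology (bandLimited L)) U ∧
      SeparatesOrbitsOn Φ U

end

/-! The bound compares the size of a fibre with the size of an orbit. A `C¹` map to `ℝ^k` has,
inside any nonempty open `U`, a fibre of dimension at least `dim V_L - k`. If `Φ` separates orbits
on `U`, that part of the fibre lies in one orbit, and an orbit has dimension at most `3`. Hence `(L
+ 1)² ≤ k + 3`.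

Dimension is measured without manifolds. `exists_projection_fibre_mem_nhds` gives a linear
projection to `ℝⁿ`, with `n ≥ dim V_L - k`, under which the fibre covers a neighbourhood.
`exists_contDiff_orbit` puts the projected orbit inside the range of a `C¹` map from `ℝ³` (Euler
angles). For `n > 3` such a range has dense complement, a contradiction.

The dimension of `V_L` comes from the linear independence of the spherical harmonics
(`eq_zero_of_sum_sphHarm`): longitude separates the orders `m`, and then polynomial degree separates
the `ℓ`. -/

/-! ### Fibres of `C¹` maps near a point of maximal rank -/

/-- A `C¹` map from a finite-dimensional space has, over every nonempty open set `U`, a fibre which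
contains a piece of dimension at least `dim E - dim F`: some linear projection of the part of the
fibre in `U` is a neighbourhood of a point. -/
theorem exists_projection_fibre_mem_nhds {E F : Type*} [NormedAddCommGroup E] [NormedSpace ℝ E]
    [FiniteDimensional ℝ E] [NormedAddCommGroup F] [NormedSpace ℝ F] [FiniteDimensional ℝ F]
    {Φ : E → F} (hΦ : ContDiff ℝ 1 Φ) {U : Set E} (hU : IsOpen U) (hne : U.Nonempty) :
    ∃ x ∈ U, ∃ (n : ℕ) (π : E →ₗ[ℝ] (Fin n → ℝ)) (b : Fin n → ℝ),
      Module.finrank ℝ E ≤ n + Module.finrank ℝ F ∧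
      π '' {y ∈ U | Φ y = Φ x} ∈ nhds b := by
  classical
  have : CompleteSpace E := FiniteDimensional.complete ℝ E
  have hdiff : Differentiable ℝ Φ := hΦ.differentiable one_ne_zero
  -- a point of maximal rank
  obtain ⟨x, hxU, hmax⟩ : ∃ x ∈ U, ∀ y ∈ U,
      Module.finrank ℝ (fderiv ℝ Φ y).range ≤ Module.finrank ℝ (fderiv ℝ Φ x).range := by
    have hfin : ((fun y => Module.finrank ℝ (fderiv ℝ Φ y).range) '' U).Finite := by
      refine (Set.finite_Iic (Module.finrank ℝ F)).subset ?_
      rintro _ ⟨y, -, rfl⟩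
      exact Submodule.finrank_le _
    obtain ⟨x, hx, hm⟩ := Set.exists_max_image _ id hfin (hne.image _)
    obtain ⟨x', hx', rfl⟩ := hx
    exact ⟨x', hx', fun y hy => hm _ ⟨y, hy, rfl⟩⟩
  set A := fderiv ℝ Φ x with hA
  set R : Submodule ℝ F := A.range with hR
  set K : Submodule ℝ E := A.ker with hK
  obtain ⟨P₀, hP₀⟩ := R.subtype.exists_leftInverse_of_injective R.ker_subtype
  obtain ⟨π₀, hπ₀⟩ := K.subtype.exists_leftInverse_of_injective K.ker_subtype
  set P : F →L[ℝ] R := P₀.toContinuousLinearMap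
  set π : E →L[ℝ] K := π₀.toContinuousLinearMap
  have hP : ∀ r : R, P r = r := fun r => LinearMap.congr_fun hP₀ r
  have hπ : ∀ v : K, π v = v := fun v => LinearMap.congr_fun hπ₀ v
  have hdim : Module.finrank ℝ R + Module.finrank ℝ K = Module.finrank ℝ E :=
    LinearMap.finrank_range_add_finrank_ker (A : E →ₗ[ℝ] F)
  -- `P` and `π` are linear projections onto the range and the kernel of `A`, so `D` is an
  -- isomorphism and `(P ∘ Φ, π)` is a local diffeomorphism at `x`.
  let D : E →L[ℝ] R × K := (P.comp A).prod π
  have hDinj : Function.Injective (D : E →ₗ[ℝ] R × K) := by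
    rw [← LinearMap.ker_eq_bot, LinearMap.ker_eq_bot']
    intro v hv
    have h1 : P (A v) = 0 := congrArg Prod.fst hv
    have h2 : π v = 0 := congrArg Prod.snd hv
    have h3 : A v = 0 := by
      have := hP ⟨A v, ⟨v, rfl⟩⟩
      rw [h1] at this
      exact (congrArg Subtype.val this).symm
    have h4 := hπ ⟨v, h3⟩
    rw [h2] at h4
    exact (congrArg Subtype.val h4).symm
  let e : E ≃L[ℝ] R × K := (LinearEquiv.ofInjectiveOfFinrankEq (D : E →ₗ[ℝ] R × K) hDinj
    (by rw [Module.finrank_prod, hdim])).toContinuousLinearEquiv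
  have he : (e : E →L[ℝ] R × K) = D := by ext v <;> rfl
  let Ψ : E → R × K := fun y => (P (Φ y), π y)
  have hΨ : ContDiff ℝ 1 Ψ := (P.contDiff.comp hΦ).prodMk π.contDiff
  have hΨ' : HasFDerivAt Ψ (e : E →L[ℝ] R × K) x := by
    rw [he]
    exact (P.hasFDerivAt.comp x (hdiff x).hasFDerivAt).prodMk π.hasFDerivAt
  set G := hΨ.contDiffAt.localInverse hΨ' one_ne_zero with hG
  have hGx : G (Ψ x) = x := hΨ.contDiffAt.localInverse_apply_image hΨ' one_ne_zero
  have hGc : ContDiffAt ℝ 1 G (Ψ x) := hΨ.contDiffAt.to_localInverse hΨ' one_ne_zero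
  have hGr : ∀ᶠ y in nhds (Ψ x), Ψ (G y) = y :=
    (hΨ.contDiffAt.hasStrictFDerivAt' hΨ' one_ne_zero).eventually_right_inverse
  have hGd : ∀ᶠ y in nhds (Ψ x), DifferentiableAt ℝ G y :=
    (hGc.eventually (by simp)).mono fun y hy => hy.differentiableAt one_ne_zero
  have hGU : ∀ᶠ y in nhds (Ψ x), G y ∈ U :=
    hGc.continuousAt.preimage_mem_nhds (by rw [hGx]; exact hU.mem_nhds hxU)
  obtain ⟨ε, hε, hball⟩ := Metric.eventually_nhds_iff_ball.1
    ((hGr.eventually_nhds.and hGd).and hGU)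
  have hmem : ∀ b ∈ Metric.ball (π x) ε, ((P (Φ x), b) : R × K) ∈ Metric.ball (Ψ x) ε := by
    intro b hb
    rw [Metric.mem_ball, Prod.dist_eq]
    simpa [Ψ, hε] using hb
  -- the derivative along the fibre vanishes
  have hker : ∀ y ∈ Metric.ball (Ψ x) ε, ∀ v : K, fderiv ℝ Φ (G y) (fderiv ℝ G y (0, v)) = 0 := by
    intro y hy v
    obtain ⟨⟨hr, hd⟩, hu⟩ := hball y hy
    set B := fderiv ℝ Φ (G y)
    have hcomp : ∀ w : R × K, P (B (fderiv ℝ G y w)) = w.1 := by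
      have h1 : HasFDerivAt (fun y => (Ψ (G y)).1) (P.comp (B.comp (fderiv ℝ G y))) y :=
        P.hasFDerivAt.comp y ((hdiff (G y)).hasFDerivAt.comp y hd.hasFDerivAt)
      have h2 : HasFDerivAt (fun y => (Ψ (G y)).1) (ContinuousLinearMap.fst ℝ R K) y :=
        hasFDerivAt_fst.congr_of_eventuallyEq (hr.mono fun z hz => by simp only [hz])
      intro w
      exact congrArg (fun T : R × K →L[ℝ] R => T w) (h1.unique h2)
    -- `P` maps the range of `B` onto `R`. By maximality of the rank at `x` that range is no larger
    -- than `R`, so `P` is injective on it.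
    let Q : B.range →ₗ[ℝ] R := P.toLinearMap.domRestrict B.range
    have hQs : Function.Surjective Q := fun r =>
      ⟨⟨B (fderiv ℝ G y (r, 0)), ⟨_, rfl⟩⟩, hcomp (r, 0)⟩
    have hQi : Function.Injective Q := by
      have hle := hmax (G y) hu
      have hge := LinearMap.finrank_le_finrank_of_surjective hQs
      exact (LinearMap.injective_iff_surjective_of_finrank_eq_finrank (le_antisymm hle hge)).2 hQs
    have h0 : Q ⟨B (fderiv ℝ G y (0, v)), ⟨_, rfl⟩⟩ = 0 := hcomp (0, v)
    exact congrArg Subtype.val (hQi (h0.trans Q.map_zero.symm))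
  have hconst : ∀ b ∈ Metric.ball (π x) ε, Φ (G (P (Φ x), b)) = Φ x := by
    have hder : ∀ b ∈ Metric.ball (π x) ε,
        HasFDerivAt (fun b => Φ (G (P (Φ x), b))) (0 : K →L[ℝ] F) b := by
      intro b hb
      have hd := (hball _ (hmem b hb)).1.2
      have h := (hdiff (G (P (Φ x), b))).hasFDerivAt.comp b
        (hd.hasFDerivAt.comp b (hasFDerivAt_prodMk_right (𝕜 := ℝ) (P (Φ x)) b))
      refine h.congr_fderiv ?_
      ext v
      exact hker _ (hmem b hb) v
    intro b hb
    have := (convex_ball (π x) ε).is_const_of_fderivWithin_eq_zero (𝕜 := ℝ)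
      (f := fun b => Φ (G (P (Φ x), b)))
      (fun b hb => (hder b hb).differentiableAt.differentiableWithinAt)
      (fun b hb => (hder b hb).hasFDerivWithinAt.fderivWithin
        (Metric.isOpen_ball.uniqueDiffWithinAt hb)) hb (Metric.mem_ball_self hε)
    exact this.trans (congrArg Φ hGx)
  let c : K ≃L[ℝ] (Fin (Module.finrank ℝ K) → ℝ) :=
    (Module.finBasis ℝ K).equivFun.toContinuousLinearEquiv
  refine ⟨x, hxU, Module.finrank ℝ K, c.toLinearMap ∘ₗ π.toLinearMap, c (π x), ?_, ?_⟩
  · rw [← hdim, add_comm]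
    exact Nat.add_le_add_left (Submodule.finrank_le R) _
  · refine Filter.mem_of_superset
      (c.toHomeomorph.isOpenMap.image_mem_nhds (Metric.ball_mem_nhds (π x) hε)) ?_
    rintro _ ⟨b, hb, rfl⟩
    obtain ⟨⟨hr, -⟩, hu⟩ := hball _ (hmem b hb)
    exact ⟨G (P (Φ x), b), ⟨hu, hconst b hb⟩, congrArg c (congrArg Prod.snd hr.self_of_nhds)⟩

/-! ### Linear independence of the spherical harmonics -/

open Polynomial in
theorem natDegree_legendreP_le (l : ℕ) : (legendreP l).natDegree ≤ l := by
  unfold legendreP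
  refine (natDegree_C_mul_le _ _).trans ((natDegree_iterate_derivative _ _).trans ?_)
  have h : ((X ^ 2 - 1 : ℝ[X]) ^ l).natDegree ≤ l * 2 :=
    natDegree_pow_le_of_le l (by compute_degree)
  omega

open Polynomial in
theorem coeff_legendreP_self_ne_zero (l : ℕ) : (legendreP l).coeff l ≠ 0 := by
  have hmonic : ((X ^ 2 - 1 : ℝ[X]) ^ l).Monic := (monic_X_pow_sub_C (1 : ℝ) two_ne_zero).pow l
  have hdeg : ((X ^ 2 - 1 : ℝ[X]) ^ l).natDegree = l + l := by
    rw [natDegree_pow, show (X ^ 2 - 1 : ℝ[X]) = X ^ 2 - C 1 by simp, natDegree_X_pow_sub_C]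
    ring
  have hc : ((X ^ 2 - 1 : ℝ[X]) ^ l).coeff (l + l) = 1 := by
    rw [← hdeg]
    exact hmonic.coeff_natDegree
  rw [legendreP, coeff_C_mul, coeff_iterate_derivative, hc]
  have : (l + l).descFactorial l ≠ 0 := by
    rw [Ne, Nat.descFactorial_eq_zero_iff_lt]
    omega
  have h2 : (l.factorial : ℝ) ≠ 0 := by exact_mod_cast l.factorial_ne_zero
  simp [this, h2]

open Polynomial in
theorem coeff_iterate_derivative_legendreP_ne_zero {l n : ℕ} (h : n ≤ l) :
    (derivative^[n] (legendreP l)).coeff (l - n) ≠ 0 := by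
  rw [coeff_iterate_derivative, Nat.sub_add_cancel h]
  have : l.descFactorial n ≠ 0 := by
    rw [Ne, Nat.descFactorial_eq_zero_iff_lt]
    omega
  simpa [this] using coeff_legendreP_self_ne_zero l

open Polynomial in
/-- For fixed `n`, the derivatives `P_l^{(n)}` with `l ≥ n` are linearly independent, even as
functions on `(-1, 1)`. -/
theorem eq_zero_of_sum_iterate_derivative_legendreP (n : ℕ) (s : Finset ℕ) (hs : ∀ l ∈ s, n ≤ l)
    (a : ℕ → ℂ) (h : ∀ z ∈ Set.Ioo (-1 : ℝ) 1,
      ∑ l ∈ s, a l * (((derivative^[n] (legendreP l)).eval z : ℝ) : ℂ) = 0) :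
    ∀ l ∈ s, a l = 0 := by
  set q : ℂ[X] := ∑ l ∈ s, C (a l) * (derivative^[n] (legendreP l)).map Complex.ofRealHom with hq
  have hq0 : q = 0 := by
    refine eq_of_infinite_eval_eq q 0 ?_
    refine Set.Infinite.mono (s := Complex.ofReal '' Set.Ioo (-1 : ℝ) 1) ?_
      ((Set.Ioo_infinite (by norm_num)).image Complex.ofReal_injective.injOn)
    rintro _ ⟨z, hz, rfl⟩
    rw [Set.mem_ofPred_eq, eval_zero, hq, eval_finsetSum, ← h z hz]
    refine Finset.sum_congr rfl fun l _ => ?_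
    rw [eval_mul, eval_C]
    congr 1
    exact eval_map_apply Complex.ofRealHom z
  by_contra! hne
  -- The `n`-th derivative of `P_l` has degree exactly `l - n`, so only the largest `l₀` with `a l₀
  -- ≠ 0` contributes in degree `l₀ - n`.
  obtain ⟨l₀, hl₀, hmax⟩ := Finset.exists_max_image (s.filter fun l => a l ≠ 0) id
    (by obtain ⟨l, hl, hl'⟩ := hne; exact ⟨l, Finset.mem_filter.2 ⟨hl, hl'⟩⟩)
  rw [Finset.mem_filter] at hl₀
  have hc : q.coeff (l₀ - n) = a l₀ * ((derivative^[n] (legendreP l₀)).coeff (l₀ - n) : ℝ) := by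
    rw [hq, finsetSum_coeff, Finset.sum_eq_single l₀]
    · simp
    · intro l hl hne'
      by_cases hal : a l = 0
      · simp [hal]
      have hlt : l < l₀ := lt_of_le_of_ne (hmax l (Finset.mem_filter.2 ⟨hl, hal⟩)) hne'
      have : (derivative^[n] (legendreP l)).coeff (l₀ - n) = 0 := by
        refine coeff_eq_zero_of_natDegree_lt ?_
        have h1 := natDegree_iterate_derivative (legendreP l) n
        have h2 := natDegree_legendreP_le l
        have h3 := hs l hl
        omega
      simp [this]
    · exact fun h' => absurd hl₀.1 h'
  rw [hq0, coeff_zero] at hc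
  exact mul_ne_zero hl₀.2
    (by exact_mod_cast coeff_iterate_derivative_legendreP_ne_zero (hs l₀ hl₀.1)) hc.symm

/-- The characters `w ↦ w ^ m` of the circle are linearly independent. -/
theorem eq_zero_of_sum_mul_zpow (s : Finset ℤ) (h : ℤ → ℂ)
    (hs : ∀ w : Circle, ∑ m ∈ s, h m * (w : ℂ) ^ m = 0) : ∀ m ∈ s, h m = 0 := by
  let χ : ℤ → (Circle →* ℂ) := fun m => Circle.coeHom.comp (zpowGroupHom m)
  have hχ : Function.Injective χ := by
    intro m n hmn
    by_contra hne
    have hd : ((m - n : ℤ) : ℝ) ≠ 0 := by exact_mod_cast sub_ne_zero.2 hne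
    -- The `(m - n)`-th power of this point is `exp (iπ) = -1`, so it tells the two characters
    -- apart.
    have h1 : (Circle.exp (Real.pi / (m - n : ℤ))) ^ m = Circle.exp (Real.pi / (m - n : ℤ)) ^ n :=
      Circle.ext (DFunLike.congr_fun hmn (Circle.exp (Real.pi / (m - n : ℤ))))
    have h2 : (Circle.exp (Real.pi / (m - n : ℤ))) ^ (m - n) = 1 := by
      rw [zpow_sub, h1, mul_inv_cancel]
    rw [← Circle.exp_zsmul, zsmul_eq_mul, mul_div_cancel₀ _ hd] at h2
    exact Circle.exp_pi_ne_one h2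
  have hli := (linearIndependent_monoidHom Circle ℂ).comp χ hχ
  refine linearIndependent_iff'.1 hli s h ?_
  ext w
  have hw : ∀ m, χ m w = (w : ℂ) ^ m := fun _ => rfl
  simpa [hw] using hs w

/-- The point of the sphere with height `z`, distance `s` from the axis and longitude `w`. -/
noncomputable def cylPoint (w : Circle) (s z : ℝ) (h : s ^ 2 + z ^ 2 = 1) : S2 :=
  ⟨!₂[s * (w : ℂ).re, s * (w : ℂ).im, z], by
    have hw : (w : ℂ).re ^ 2 + (w : ℂ).im ^ 2 = 1 := by
      have := Circle.normSq_coe w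
      rw [Complex.normSq_apply] at this
      linarith
    rw [mem_sphere_zero_iff_norm, ← sq_eq_sq₀ (norm_nonneg _) zero_le_one,
      EuclideanSpace.real_norm_sq_eq, Fin.sum_univ_three]
    simp only [Matrix.cons_val]
    linear_combination s ^ 2 * hw + h⟩

/-- The factor of `Y_l^m` that does not depend on the point. -/
noncomputable def sphHarmConst (l : ℕ) (m : ℤ) : ℂ :=
  (Real.sqrt ((2 * (l : ℝ) + 1) / (4 * Real.pi) *
    (((l - m.natAbs).factorial : ℝ) / ((l + m.natAbs).factorial : ℝ))) : ℝ) *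
    (if 0 ≤ m then (-1) ^ m.natAbs else 1)

theorem sphHarmConst_ne_zero (l : ℕ) (m : ℤ) : sphHarmConst l m ≠ 0 := by
  unfold sphHarmConst
  refine mul_ne_zero ?_ (by split_ifs <;> simp)
  rw [Complex.ofReal_ne_zero, Real.sqrt_ne_zero']
  have := Real.pi_pos
  positivity

/-- Separation of variables: the longitude enters only through the character `w ^ m`. -/
theorem sphHarm_cylPoint (l : ℕ) (m : ℤ) (w : Circle) (s z : ℝ) (h : s ^ 2 + z ^ 2 = 1) :
    sphHarm l m (cylPoint w s z h) = sphHarmConst l m *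
      (((Polynomial.derivative^[m.natAbs] (legendreP l)).eval z : ℝ) : ℂ) * (s : ℂ) ^ m.natAbs *
        (w : ℂ) ^ m := by
  have hn : ∀ n : ℕ, sphHarmNonneg l n (cylPoint w s z h) =
      (Real.sqrt ((2 * (l : ℝ) + 1) / (4 * Real.pi) *
        (((l - n).factorial : ℝ) / ((l + n).factorial : ℝ))) : ℝ) * (-1) ^ n *
      (((Polynomial.derivative^[n] (legendreP l)).eval z : ℝ) : ℂ) * (s : ℂ) ^ n * (w : ℂ) ^ n := by
    intro n
    have hw : (((cylPoint w s z h).1 0 : ℝ) : ℂ) + Complex.I * (((cylPoint w s z h).1 1 : ℝ) : ℂ) =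
        s * w := by
      simp only [cylPoint, PiLp.toLp_apply, Matrix.cons_val]
      conv_rhs => rw [← Complex.re_add_im (w : ℂ)]
      push_cast
      ring
    have hz : (cylPoint w s z h).1 2 = z := by simp [cylPoint]
    rw [sphHarmNonneg, hw, hz, mul_pow]
    ring
  unfold sphHarm sphHarmConst
  rw [hn]
  split_ifs with hm
  · obtain ⟨n, rfl⟩ := Int.eq_ofNat_of_zero_le hm
    simp
  · obtain ⟨n, hn'⟩ := Int.eq_ofNat_of_zero_le (le_of_lt (neg_pos.2 (not_le.1 hm)))
    obtain rfl : m = -(n : ℤ) := by omega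
    -- For negative `m` the Condon-Shortley sign cancels the sign in the definition of `Y_l^{-n}`,
    -- which is why `sphHarmConst` has no sign there.
    have hsq : ((-1 : ℂ) ^ n) * (-1) ^ n = 1 := by rw [← mul_pow]; simp
    simp only [Int.natAbs_neg, Int.natAbs_natCast, map_mul, map_pow, map_neg, map_one,
      Complex.conj_ofReal, zpow_neg, zpow_natCast, ← Circle.coe_inv_eq_conj, Circle.coe_inv,
      inv_pow]
    linear_combination (Real.sqrt ((2 * (l : ℝ) + 1) / (4 * Real.pi) *
        (((l - n).factorial : ℝ) / ((l + n).factorial : ℝ))) : ℝ) *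
      (((Polynomial.derivative^[n] (legendreP l)).eval z : ℝ) : ℂ) * (s : ℂ) ^ n *
        ((w : ℂ) ^ n)⁻¹ * hsq

/-- The spherical harmonics of degree at most `L` are linearly independent. -/
theorem eq_zero_of_sum_sphHarm (L : ℕ) (a : ℕ → ℤ → ℂ)
    (h : ∀ p, ∑ l ∈ Finset.range (L + 1), ∑ m ∈ Finset.Icc (-(l : ℤ)) (l : ℤ),
      a l m * sphHarm l m p = 0) :
    ∀ l ∈ Finset.range (L + 1), ∀ m ∈ Finset.Icc (-(l : ℤ)) (l : ℤ), a l m = 0 := by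
  have key : ∀ m ∈ Finset.Icc (-(L : ℤ)) (L : ℤ), ∀ z ∈ Set.Ioo (-1 : ℝ) 1,
      ∑ l ∈ (Finset.range (L + 1)).filter (fun l => m.natAbs ≤ l), a l m * sphHarmConst l m *
        (((Polynomial.derivative^[m.natAbs] (legendreP l)).eval z : ℝ) : ℂ) = 0 := by
    intro m hm z hz
    have hpos : 0 < 1 - z ^ 2 := by nlinarith [hz.1, hz.2]
    set s := Real.sqrt (1 - z ^ 2)
    have hs0 : (s : ℂ) ≠ 0 := Complex.ofReal_ne_zero.2 (Real.sqrt_pos.2 hpos).ne'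
    have hsz : s ^ 2 + z ^ 2 = 1 := by rw [Real.sq_sqrt hpos.le]; ring
    -- On the circle of height `z` the relation is a trigonometric polynomial in `w`; each of its
    -- coefficients vanishes.
    have hsum := eq_zero_of_sum_mul_zpow (Finset.Icc (-(L : ℤ)) (L : ℤ))
      (fun m => (∑ l ∈ (Finset.range (L + 1)).filter (fun l => m.natAbs ≤ l),
        a l m * sphHarmConst l m *
        (((Polynomial.derivative^[m.natAbs] (legendreP l)).eval z : ℝ) : ℂ)) * (s : ℂ) ^ m.natAbs)
      (fun w => by
        rw [← h (cylPoint w s z hsz)]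
        simp only [Finset.sum_mul]
        rw [Finset.sum_comm' (t' := Finset.range (L + 1))
          (s' := fun l => Finset.Icc (-(l : ℤ)) (l : ℤ))]
        · refine Finset.sum_congr rfl fun l _ => Finset.sum_congr rfl fun m _ => ?_
          rw [sphHarm_cylPoint]
          ring
        · intro m l
          simp only [Finset.mem_filter, Finset.mem_range, Finset.mem_Icc]
          omega) m hm
    exact (mul_eq_zero.1 hsum).resolve_right (pow_ne_zero _ hs0)
  intro l hl m hm
  rw [Finset.mem_range] at hl
  rw [Finset.mem_Icc] at hm
  have := eq_zero_of_sum_iterate_derivative_legendreP m.natAbs _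
    (fun l hl => (Finset.mem_filter.1 hl).2) (fun l => a l m * sphHarmConst l m)
    (key m (Finset.mem_Icc.2 (by omega))) l
    (Finset.mem_filter.2 ⟨Finset.mem_range.2 hl, by omega⟩)
  exact (mul_eq_zero.1 this).resolve_right (sphHarmConst_ne_zero l m)

/-! ### The dimension of the space of band-limited signals -/

theorem continuous_sphHarmNonneg (l m : ℕ) : Continuous (sphHarmNonneg l m) := by
  unfold sphHarmNonneg
  fun_prop

theorem continuous_sphHarm (l : ℕ) (m : ℤ) : Continuous (sphHarm l m) := by
  have h := continuous_sphHarmNonneg l m.natAbs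
  unfold sphHarm
  split_ifs
  · exact h
  · exact continuous_const.mul (Complex.continuous_conj.comp h)

theorem conj_sphHarm (l : ℕ) (m : ℤ) (p : S2) :
    (starRingEnd ℂ) (sphHarm l m p) = (-1) ^ m.natAbs * sphHarm l (-m) p := by
  have hsq : ((-1 : ℂ) ^ m.natAbs) * (-1) ^ m.natAbs = 1 := by rw [← mul_pow]; simp
  rcases lt_trichotomy m 0 with hm | rfl | hm
  · rw [sphHarm, sphHarm, if_neg (not_le.2 hm), if_pos (by omega), Int.natAbs_neg]
    simp
  · simp [sphHarm, sphHarmNonneg]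
  · rw [sphHarm, sphHarm, if_pos hm.le, if_neg (by omega), Int.natAbs_neg, ← mul_assoc, hsq,
      one_mul]

/-- The space of complex signals band-limited at degree `L`. -/
def complexBandLimited (L : ℕ) : Submodule ℂ (S2 → ℂ) where
  carrier := {F | ∃ a : ℕ → ℤ → ℂ, ∀ p : S2, F p =
    ∑ l ∈ Finset.range (L + 1), ∑ m ∈ Finset.Icc (-(l : ℤ)) (l : ℤ), a l m * sphHarm l m p}
  zero_mem' := ⟨fun _ _ => 0, fun p => by simp⟩
  add_mem' := by
    rintro f g ⟨a, ha⟩ ⟨b, hb⟩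
    refine ⟨fun l m => a l m + b l m, fun p => ?_⟩
    simp only [Pi.add_apply, ha p, hb p, add_mul, Finset.sum_add_distrib]
  smul_mem' := by
    rintro c f ⟨a, ha⟩
    refine ⟨fun l m => c * a l m, fun p => ?_⟩
    simp only [Pi.smul_apply, smul_eq_mul, ha p, mul_assoc, Finset.mul_sum]

/-- Conjugation exchanges the orders `m` and `-m` up to sign. This is what keeps real and imaginary
parts band-limited. -/
theorem conj_mem_complexBandLimited {L : ℕ} {F : S2 → ℂ} (hF : F ∈ complexBandLimited L) :
    (fun p => (starRingEnd ℂ) (F p)) ∈ complexBandLimited L := by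
  obtain ⟨a, ha⟩ := hF
  refine ⟨fun l m => (starRingEnd ℂ) (a l (-m)) * (-1) ^ m.natAbs, fun p => ?_⟩
  simp only [ha p, map_sum]
  refine Finset.sum_congr rfl fun l _ => ?_
  refine Finset.sum_nbij' (fun m => -m) (fun m => -m) ?_ ?_ ?_ ?_ ?_
  · intro m hm
    simp only [Finset.mem_Icc] at hm ⊢
    omega
  · intro m hm
    simp only [Finset.mem_Icc] at hm ⊢
    omega
  · simp
  · simp
  · intro m _
    rw [map_mul, conj_sphHarm, neg_neg, Int.natAbs_neg, mul_assoc]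

theorem continuous_of_mem_complexBandLimited {L : ℕ} {F : S2 → ℂ}
    (hF : F ∈ complexBandLimited L) : Continuous F := by
  obtain ⟨a, ha⟩ := hF
  rw [funext ha]
  exact continuous_finsetSum _ fun l _ => continuous_finsetSum _ fun m _ =>
    continuous_const.mul (continuous_sphHarm l m)

/-- The pairs `(l, m)` with `l ≤ L` and `-l ≤ m ≤ l`. -/
noncomputable abbrev degreeOrder (L : ℕ) : Finset ((_ : ℕ) × ℤ) :=
  (Finset.range (L + 1)).sigma fun l => Finset.Icc (-(l : ℤ)) (l : ℤ)

theorem card_degreeOrder (L : ℕ) : (degreeOrder L).card = (L + 1) ^ 2 := by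
  rw [Finset.card_sigma]
  induction L with
  | zero => simp
  | succ n ih =>
    rw [Finset.sum_range_succ, ih, Int.card_Icc]
    have : ((n + 1 : ℕ) + 1 - -((n + 1 : ℕ) : ℤ)).toNat = 2 * n + 3 := by omega
    rw [this]
    ring

theorem sum_extend_mul_sphHarm {L : ℕ} (c : degreeOrder L → ℂ) (p : S2) :
    ∑ l ∈ Finset.range (L + 1), ∑ m ∈ Finset.Icc (-(l : ℤ)) (l : ℤ),
      (if h : (⟨l, m⟩ : (_ : ℕ) × ℤ) ∈ degreeOrder L then c ⟨_, h⟩ else 0) * sphHarm l m p =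
    ∑ i, c i * sphHarm i.1.1 i.1.2 p := by
  rw [Finset.sum_sigma', ← Finset.sum_coe_sort]
  refine Finset.sum_congr rfl fun i _ => ?_
  rw [dif_pos i.2]

/-- The signal with given spherical harmonic coefficients. -/
noncomputable def synthesis (L : ℕ) : (degreeOrder L → ℂ) →ₗ[ℂ] complexBandLimited L where
  toFun c := ⟨fun p => ∑ i, c i * sphHarm i.1.1 i.1.2 p, _,
    fun p => (sum_extend_mul_sphHarm c p).symm⟩
  map_add' c d := by
    ext p
    simp [add_mul, Finset.sum_add_distrib]
  map_smul' r c := by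
    ext p
    simp [mul_assoc, Finset.mul_sum]

theorem synthesis_bijective (L : ℕ) : Function.Bijective (synthesis L) := by
  constructor
  · rw [← LinearMap.ker_eq_bot, LinearMap.ker_eq_bot']
    intro c hc
    have h := eq_zero_of_sum_sphHarm L _ fun p =>
      (sum_extend_mul_sphHarm c p).trans (congrFun (congrArg Subtype.val hc) p)
    ext ⟨⟨l, m⟩, hi⟩
    have hlm := h l (Finset.mem_sigma.1 hi).1 m (Finset.mem_sigma.1 hi).2
    rwa [dif_pos hi] at hlm
  · rintro ⟨F, a, ha⟩
    refine ⟨fun i => a i.1.1 i.1.2, ?_⟩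
    ext p
    change ∑ i : degreeOrder L, a i.1.1 i.1.2 * sphHarm i.1.1 i.1.2 p = F p
    rw [ha p, Finset.sum_sigma']
    exact Finset.sum_coe_sort (degreeOrder L) fun i => a i.1 i.2 * sphHarm i.1 i.2 p

/-- A complex band-limited signal is determined by its coefficients. -/
noncomputable def coeffEquiv (L : ℕ) : (degreeOrder L → ℂ) ≃ₗ[ℂ] complexBandLimited L :=
  LinearEquiv.ofBijective (synthesis L) (synthesis_bijective L)

/-- A complex band-limited signal is a pair of real ones: its real and its imaginary part. -/
noncomputable def realImEquiv (L : ℕ) :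
    (bandLimited L × bandLimited L) ≃ₗ[ℝ] complexBandLimited L :=
  LinearEquiv.ofBijective
    { toFun := fun f => ⟨fun p => (f.1.1 p : ℂ) + Complex.I * (f.2.1 p : ℂ),
        (complexBandLimited L).add_mem (x := fun p => (f.1.1 p : ℂ)) f.1.2
          ((complexBandLimited L).smul_mem Complex.I (x := fun p => (f.2.1 p : ℂ)) f.2.2)⟩
      map_add' := fun f g => by
        ext p
        simp
        ring
      map_smul' := fun r f => by
        ext p
        simp
        ring }
    (by
      constructor
      · rw [← LinearMap.ker_eq_bot, LinearMap.ker_eq_bot']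
        rintro ⟨f, g⟩ hfg
        have h : ∀ p, (f.1 p : ℂ) + Complex.I * (g.1 p : ℂ) = 0 := fun p =>
          congrFun (congrArg Subtype.val hfg) p
        ext p
        · simpa using congrArg Complex.re (h p)
        · simpa using congrArg Complex.im (h p)
      · rintro ⟨F, hF⟩
        have hc := continuous_of_mem_complexBandLimited hF
        have hconj := conj_mem_complexBandLimited hF
        refine ⟨⟨⟨⟨fun p => (F p).re, Complex.continuous_re.comp hc⟩, ?_⟩,
          ⟨⟨fun p => (F p).im, Complex.continuous_im.comp hc⟩, ?_⟩⟩, ?_⟩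
        · change (fun p => (((F p).re : ℝ) : ℂ)) ∈ complexBandLimited L
          convert (complexBandLimited L).smul_mem (1 / 2 : ℂ)
            ((complexBandLimited L).add_mem hF hconj) using 1
          ext p
          simp only [Pi.smul_apply, Pi.add_apply, smul_eq_mul, Complex.re_eq_add_conj]
          ring
        · change (fun p => (((F p).im : ℝ) : ℂ)) ∈ complexBandLimited L
          convert (complexBandLimited L).smul_mem (1 / (2 * Complex.I) : ℂ)
            ((complexBandLimited L).sub_mem hF hconj) using 1
          ext p
          simp only [Pi.smul_apply, Pi.sub_apply, smul_eq_mul, Complex.im_eq_sub_conj]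
          ring
        · ext p
          change (((F p).re : ℝ) : ℂ) + Complex.I * (((F p).im : ℝ) : ℂ) = F p
          conv_rhs => rw [← Complex.re_add_im (F p)]
          ring)

instance finiteDimensional_bandLimited (L : ℕ) : FiniteDimensional ℝ (bandLimited L) := by
  have h1 : FiniteDimensional ℂ (complexBandLimited L) := (coeffEquiv L).finiteDimensional
  have h2 : FiniteDimensional ℝ (complexBandLimited L) := FiniteDimensional.complexToReal _
  exact FiniteDimensional.of_injective
    ((realImEquiv L).toLinearMap ∘ₗ LinearMap.inl ℝ (bandLimited L) (bandLimited L))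
    ((realImEquiv L).injective.comp LinearMap.inl_injective)

/-- Two copies of the real space form the complex one, whose real dimension is twice its complex
dimension `(L + 1)²`. -/
theorem finrank_bandLimited (L : ℕ) : Module.finrank ℝ (bandLimited L) = (L + 1) ^ 2 := by
  have h1 := (realImEquiv L).finrank_eq
  have h2 := (coeffEquiv L).finrank_eq
  rw [Module.finrank_prod, finrank_real_of_complex, ← h2, Module.finrank_fintype_fun_eq_card,
    Fintype.card_coe, card_degreeOrder] at h1
  omega

/-! ### Polynomial functions and the Zariski topology -/

theorem contDiff_of_mem_polyFun {V : Type*} [NormedAddCommGroup V] [NormedSpace ℝ V]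
    [FiniteDimensional ℝ V] {n : WithTop ℕ∞} {p : V → ℝ} (hp : p ∈ polyFun V) :
    ContDiff ℝ n p := by
  induction hp using Algebra.adjoin_induction with
  | mem x hx =>
    obtain ⟨φ, rfl⟩ := hx
    exact (LinearMap.toContinuousLinearMap φ).contDiff
  | algebraMap r => exact contDiff_const
  | add x y _ _ hx hy => exact hx.add hy
  | mul x y _ _ hx hy => exact hx.mul hy

theorem continuous_of_mem_polyFun {V : Type*} [AddCommGroup V] [Module ℝ V] [TopologicalSpace V]
    [IsTopologicalAddGroup V] [ContinuousSMul ℝ V] [T2Space V] [FiniteDimensional ℝ V]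
    {p : V → ℝ} (hp : p ∈ polyFun V) : Continuous p := by
  induction hp using Algebra.adjoin_induction with
  | mem x hx =>
    obtain ⟨φ, rfl⟩ := hx
    exact φ.continuous_of_finiteDimensional
  | algebraMap r => exact continuous_const
  | add x y _ _ hx hy => exact hx.add hy
  | mul x y _ _ hx hy => exact hx.mul hy

theorem isOpen_of_isOpen_zariski {V : Type*} [AddCommGroup V] [Module ℝ V] [TopologicalSpace V]
    [IsTopologicalAddGroup V] [ContinuousSMul ℝ V] [T2Space V] [FiniteDimensional ℝ V]
    {U : Set V} (hU : @IsOpen _ (zariskiTopology V) U) : IsOpen U := by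
  induction hU with
  | basic s hs =>
    obtain ⟨p, hp, rfl⟩ := hs
    exact (continuous_of_mem_polyFun hp).isOpen_preimage _ isOpen_ne
  | univ => exact isOpen_univ
  | inter s t _ _ hs ht => exact hs.inter ht
  | sUnion S _ hS => exact isOpen_sUnion hS

/-! ### Orbits as `C¹` images of the space of Euler angles -/

/-- The Cartesian formula makes sense on all of `ℝ³`, so differentiability can be discussed without
calculus on the sphere. -/
theorem exists_contDiff_extension_sphHarm (l : ℕ) (m : ℤ) :
    ∃ H : EuclideanSpace ℝ (Fin 3) → ℂ, ContDiff ℝ 1 H ∧ ∀ p : S2, sphHarm l m p = H p.1 := by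
  have hcoord : ∀ i : Fin 3, ContDiff ℝ 1 fun v : EuclideanSpace ℝ (Fin 3) => v i := fun i =>
    contDiff_euclidean.1 contDiff_id i
  have hofReal : ∀ {u : EuclideanSpace ℝ (Fin 3) → ℝ}, ContDiff ℝ 1 u →
      ContDiff ℝ 1 fun v => (u v : ℂ) := fun hu => Complex.ofRealCLM.contDiff.comp hu
  have hN : ∀ n : ℕ, ∃ H : EuclideanSpace ℝ (Fin 3) → ℂ, ContDiff ℝ 1 H ∧
      ∀ p : S2, sphHarmNonneg l n p = H p.1 := by
    intro n
    refine ⟨fun v => (Real.sqrt ((2 * (l : ℝ) + 1) / (4 * Real.pi) *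
        (((l - n).factorial : ℝ) / ((l + n).factorial : ℝ))) : ℝ) * (-1) ^ n *
      (((Polynomial.derivative^[n] (legendreP l)).eval (v 2) : ℝ) : ℂ) *
      ((v 0 : ℂ) + Complex.I * (v 1 : ℂ)) ^ n, ?_, fun p => rfl⟩
    refine (contDiff_const.mul (hofReal ?_)).mul
      (((hofReal (hcoord 0)).add (contDiff_const.mul (hofReal (hcoord 1)))).pow n)
    have hp : ContDiff ℝ 1 fun x : ℝ => (Polynomial.derivative^[n] (legendreP l)).eval x := by
      simpa only [Polynomial.coe_aeval_eq_eval] using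
        (Polynomial.derivative^[n] (legendreP l)).contDiff_aeval (𝕜 := ℝ) 1
    exact hp.comp (hcoord 2)
  obtain ⟨H, hH, hHp⟩ := hN m.natAbs
  by_cases hm : 0 ≤ m
  · exact ⟨H, hH, fun p => by rw [sphHarm, if_pos hm, hHp]⟩
  · exact ⟨fun v => (-1) ^ m.natAbs * (starRingEnd ℂ) (H v),
      contDiff_const.mul (Complex.conjCLE.contDiff.comp hH), fun p => by
        rw [sphHarm, if_neg hm, hHp]⟩

theorem exists_contDiff_extension {L : ℕ} (f : bandLimited L) :
    ∃ F : EuclideanSpace ℝ (Fin 3) → ℝ, ContDiff ℝ 1 F ∧ ∀ p : S2, f.1 p = F p.1 := by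
  obtain ⟨a, ha⟩ := f.2
  choose H hH hHp using exists_contDiff_extension_sphHarm
  refine ⟨fun v => (∑ l ∈ Finset.range (L + 1), ∑ m ∈ Finset.Icc (-(l : ℤ)) (l : ℤ),
    a l m * H l m v).re, Complex.reCLM.contDiff.comp ?_, fun p => ?_⟩
  · exact ContDiff.sum fun l _ => ContDiff.sum fun m _ => contDiff_const.mul (hH l m)
  · have := congrArg Complex.re (ha p)
    simpa only [Complex.ofReal_re, hHp] using this

/-- Rotation by the angle `a` about the third axis. -/
noncomputable def rotZ (a : ℝ) : Matrix (Fin 3) (Fin 3) ℝ :=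
  !![Real.cos a, -Real.sin a, 0; Real.sin a, Real.cos a, 0; 0, 0, 1]

/-- Rotation by the angle `b` about the second axis. -/
noncomputable def rotY (b : ℝ) : Matrix (Fin 3) (Fin 3) ℝ :=
  !![Real.cos b, 0, Real.sin b; 0, 1, 0; -Real.sin b, 0, Real.cos b]

/-- The rotation with Euler angles `t`. -/
noncomputable def eulerMatrix (t : ℝ × ℝ × ℝ) : Matrix (Fin 3) (Fin 3) ℝ :=
  rotZ t.1 * rotY t.2.1 * rotZ t.2.2

theorem rotZ_mem (a : ℝ) : rotZ a ∈ Matrix.specialOrthogonalGroup (Fin 3) ℝ := by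
  have h := Real.sin_sq_add_cos_sq a
  rw [Matrix.mem_specialOrthogonalGroup_iff, Matrix.mem_orthogonalGroup_iff]
  constructor
  · ext i j
    fin_cases i <;> fin_cases j <;>
      simp [rotZ, Matrix.mul_apply, Fin.sum_univ_three] <;>
      first | ring1 | linear_combination h
  · simp [rotZ, Matrix.det_fin_three]
    linear_combination h

theorem rotY_mem (b : ℝ) : rotY b ∈ Matrix.specialOrthogonalGroup (Fin 3) ℝ := by
  have h := Real.sin_sq_add_cos_sq b
  rw [Matrix.mem_specialOrthogonalGroup_iff, Matrix.mem_orthogonalGroup_iff]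
  constructor
  · ext i j
    fin_cases i <;> fin_cases j <;>
      simp [rotY, Matrix.mul_apply, Fin.sum_univ_three] <;>
      first | ring1 | linear_combination h
  · simp [rotY, Matrix.det_fin_three]
    linear_combination h

theorem exists_cos_sin_eq {x y : ℝ} (h : x ^ 2 + y ^ 2 = 1) :
    ∃ a, Real.cos a = x ∧ Real.sin a = y := by
  have hn : ‖(⟨x, y⟩ : ℂ)‖ = 1 := by
    rw [← sq_eq_sq₀ (norm_nonneg _) zero_le_one, Complex.sq_norm, Complex.normSq_mk]
    linarith
  refine ⟨Complex.arg ⟨x, y⟩, ?_, ?_⟩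
  · simpa [hn] using Complex.norm_mul_cos_arg ⟨x, y⟩
  · simpa [hn] using Complex.norm_mul_sin_arg ⟨x, y⟩

theorem exists_spherical_coordinates {x y z : ℝ} (h : x ^ 2 + y ^ 2 + z ^ 2 = 1) :
    ∃ a b, Real.cos a * Real.sin b = x ∧ Real.sin a * Real.sin b = y ∧ Real.cos b = z := by
  set r := ‖(⟨x, y⟩ : ℂ)‖ with hr
  have hr2 : r ^ 2 = x ^ 2 + y ^ 2 := by
    rw [hr, Complex.sq_norm, Complex.normSq_mk]
    ring
  obtain ⟨b, hb, hb'⟩ := exists_cos_sin_eq (x := z) (y := r) (by linarith)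
  refine ⟨Complex.arg ⟨x, y⟩, b, ?_, ?_, hb⟩
  · rw [hb', mul_comm]
    exact Complex.norm_mul_cos_arg ⟨x, y⟩
  · rw [hb', mul_comm]
    exact Complex.norm_mul_sin_arg ⟨x, y⟩

/-- A rotation that fixes the third basis vector is a rotation about the third axis. -/
theorem exists_eq_rotZ {N : Matrix (Fin 3) (Fin 3) ℝ}
    (hN : N ∈ Matrix.specialOrthogonalGroup (Fin 3) ℝ)
    (h0 : N 0 2 = 0) (h1 : N 1 2 = 0) (h2 : N 2 2 = 1) : ∃ c, N = rotZ c := by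
  rw [Matrix.mem_specialOrthogonalGroup_iff] at hN
  obtain ⟨hO, hdet⟩ := hN
  have hr : ∀ i j, (N * N.transpose) i j = (1 : Matrix (Fin 3) (Fin 3) ℝ) i j := fun i j => by
    rw [(Matrix.mem_orthogonalGroup_iff _ _).1 hO]
  have hc : ∀ i j, (N.transpose * N) i j = (1 : Matrix (Fin 3) (Fin 3) ℝ) i j := fun i j => by
    rw [(Matrix.mem_orthogonalGroup_iff' _ _).1 hO]
  simp only [Matrix.mul_apply, Fin.sum_univ_three, Matrix.transpose_apply] at hr hc
  rw [Matrix.det_fin_three] at hdet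
  have e22 := hr 2 2
  have c00 := hc 0 0
  have c01 := hc 0 1
  simp only [h2, Matrix.one_apply_eq] at e22
  -- The last row is a unit vector whose last entry is already `1`.
  have h20 : N 2 0 = 0 := by nlinarith [sq_nonneg (N 2 0), sq_nonneg (N 2 1)]
  have h21 : N 2 1 = 0 := by nlinarith [sq_nonneg (N 2 0), sq_nonneg (N 2 1)]
  simp only [h0, h1, h2, h20, h21, Matrix.one_apply_eq] at c00 c01 hdet
  rw [Matrix.one_apply_ne (by decide)] at c01
  have h11 : N 1 1 = N 0 0 := by
    linear_combination (-N 1 1) * c00 + N 1 0 * c01 + N 0 0 * hdet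
  have h01 : N 0 1 = -N 1 0 := by
    linear_combination (-N 0 1) * c00 + N 0 0 * c01 - N 1 0 * hdet
  obtain ⟨c, hcos, hsin⟩ := exists_cos_sin_eq (x := N 0 0) (y := N 1 0) (by linarith)
  refine ⟨c, ?_⟩
  ext i j
  fin_cases i <;> fin_cases j <;> simp [rotZ, *]

/-- Spherical coordinates of the last column of `g` give a rotation `Q` with the same last column;
then `Q⁻¹ g` fixes the third axis. -/
theorem exists_eq_eulerMatrix (g : SO3) : ∃ t, (g : Matrix (Fin 3) (Fin 3) ℝ) = eulerMatrix t := by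
  obtain ⟨M, hM⟩ := g
  have hcol : M 0 2 ^ 2 + M 1 2 ^ 2 + M 2 2 ^ 2 = 1 := by
    have h := (Matrix.mem_orthogonalGroup_iff' _ _).1
      (Matrix.mem_specialOrthogonalGroup_iff.1 hM).1
    have h22 := congrFun (congrFun h 2) 2
    simp only [Matrix.mul_apply, Fin.sum_univ_three, Matrix.transpose_apply,
      Matrix.one_apply_eq] at h22
    linarith
  obtain ⟨a, b, hx, hy, hz⟩ := exists_spherical_coordinates hcol
  let Q : SO3 := ⟨rotZ a, rotZ_mem a⟩ * ⟨rotY b, rotY_mem b⟩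
  let N : SO3 := Q⁻¹ * ⟨M, hM⟩
  have ha := Real.sin_sq_add_cos_sq a
  have hb := Real.sin_sq_add_cos_sq b
  have hN : (N : Matrix (Fin 3) (Fin 3) ℝ) = star (rotZ a * rotY b) * M := rfl
  obtain ⟨c, hc⟩ := exists_eq_rotZ N.2
    (by
      simp [hN, Matrix.mul_apply, Fin.sum_univ_three, rotZ, rotY, ← hx, ← hy, ← hz]
      linear_combination Real.cos b * Real.sin b * ha)
    (by
      simp [hN, Matrix.mul_apply, Fin.sum_univ_three, rotZ, rotY, ← hx, ← hy, ← hz]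
      ring)
    (by
      simp [hN, Matrix.mul_apply, Fin.sum_univ_three, rotZ, rotY, ← hx, ← hy, ← hz]
      linear_combination Real.sin b ^ 2 * ha + hb)
  refine ⟨(a, b, c), ?_⟩
  have h : (⟨M, hM⟩ : SO3) = Q * N := (mul_inv_cancel_left _ _).symm
  have h' := congrArg Subtype.val h
  rw [eulerMatrix, ← hc]
  exact h'

theorem contDiff_eulerMatrix_mulVec (v : EuclideanSpace ℝ (Fin 3)) :
    ContDiff ℝ 1 fun t => WithLp.toLp 2 ((eulerMatrix t).mulVec (WithLp.ofLp v)) := by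
  rw [contDiff_euclidean]
  intro i
  fin_cases i <;>
    simp only [eulerMatrix, rotZ, rotY, Matrix.mul_apply, Matrix.mulVec, dotProduct,
      Fin.sum_univ_three] <;> simp <;> fun_prop

/-- A linear functional, evaluated along the orbit of a band-limited signal, is a `C¹` function of
the Euler angles. -/
theorem exists_contDiff_dual_orbit {L : ℕ} (f : bandLimited L)
    (φ : Module.Dual ℝ (bandLimited L)) :
    ∃ γ : ℝ × ℝ × ℝ → ℝ, ContDiff ℝ 1 γ ∧ ∀ (h : SO3) (t : ℝ × ℝ × ℝ) (f' : bandLimited L),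
      (h : Matrix (Fin 3) (Fin 3) ℝ) = eulerMatrix t → (∀ p, f'.1 p = f.1 (rotatePoint h p)) →
        φ f' = γ t := by
  let ev : S2 → Module.Dual ℝ (bandLimited L) := fun p =>
    { toFun := fun f => f.1 p
      map_add' := fun _ _ => rfl
      map_smul' := fun _ _ => rfl }
  -- Point evaluations separate signals, hence span the finite-dimensional dual; it suffices to
  -- treat one evaluation.
  have hspan : Submodule.span ℝ (Set.range ev) = ⊤ := by
    refine Submodule.span_eq_top_of_ne_zero fun f' hf' => ?_
    by_contra! hall
    exact hf' (Subtype.ext (ContinuousMap.ext fun p => hall _ ⟨p, rfl⟩))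
  obtain ⟨F, hF, hFp⟩ := exists_contDiff_extension f
  have hφ : φ ∈ Submodule.span ℝ (Set.range ev) := hspan ▸ Submodule.mem_top
  induction hφ using Submodule.span_induction with
  | mem φ hφ =>
    obtain ⟨p, rfl⟩ := hφ
    refine ⟨_, hF.comp (contDiff_eulerMatrix_mulVec p.1), fun h t f' ht hf' => ?_⟩
    change f'.1 p = _
    rw [hf' p, hFp]
    simp only [rotatePoint, Function.comp_apply, ht]
  | zero => exact ⟨0, contDiff_const, fun _ _ _ _ _ => rfl⟩
  | add φ ψ _ _ hφ hψ =>
    obtain ⟨γ, hγ, h1⟩ := hφ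
    obtain ⟨δ, hδ, h2⟩ := hψ
    exact ⟨_, hγ.add hδ, fun h t f' ht hf' => congrArg₂ (· + ·) (h1 h t f' ht hf')
      (h2 h t f' ht hf')⟩
  | smul r φ _ hφ =>
    obtain ⟨γ, hγ, h1⟩ := hφ
    exact ⟨_, hγ.const_smul r, fun h t f' ht hf' => congrArg (r • ·) (h1 h t f' ht hf')⟩

/-- The image of an orbit under a linear map is contained in the range of a `C¹` map on `ℝ³`. -/
theorem exists_contDiff_orbit {L n : ℕ} (f : bandLimited L)
    (π : bandLimited L →ₗ[ℝ] (Fin n → ℝ)) :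
    ∃ Γ : ℝ × ℝ × ℝ → (Fin n → ℝ), ContDiff ℝ 1 Γ ∧
      ∀ (g : SO3) (f' : bandLimited L), (f' : C(S2, ℝ)) = rotate g f → π f' ∈ Set.range Γ := by
  choose γ hγ hγ' using fun i => exists_contDiff_dual_orbit f (LinearMap.proj i ∘ₗ π)
  refine ⟨fun t i => γ i t, contDiff_pi.2 hγ, fun g f' hf' => ?_⟩
  -- The action on signals is by `f (g⁻¹ x)`, so the Euler angles of the inverse are needed.
  obtain ⟨t, ht⟩ := exists_eq_eulerMatrix g⁻¹
  refine ⟨t, ?_⟩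
  ext i
  exact (hγ' i g⁻¹ t f' ht fun p => by rw [hf']; rfl).symm

/-! ### The lower bound -/

theorem IsCompleteInvariant.contDiff {L k : ℕ} {Φ : bandLimited L → EuclideanSpace ℝ (Fin k)}
    (h : IsCompleteInvariant L k Φ) : ContDiff ℝ 1 Φ := by
  rcases h.smooth_or_polynomial with hs | hp
  · exact hs.of_le (by exact_mod_cast le_top)
  · exact contDiff_euclidean.2 fun i => contDiff_of_mem_polyFun (hp i)

theorem IsCompleteInvariant.sq_le {L k : ℕ} {Φ : bandLimited L → EuclideanSpace ℝ (Fin k)}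
    (h : IsCompleteInvariant L k Φ) : (L + 1) ^ 2 ≤ k + 3 := by
  obtain ⟨U, hUo, hUd, hsep⟩ := h.separates
  have hne : U.Nonempty := @Dense.nonempty _ (zariskiTopology (bandLimited L)) _ _ hUd
  obtain ⟨f, hfU, n, π, b, hdim, hnhds⟩ :=
    exists_projection_fibre_mem_nhds h.contDiff (isOpen_of_isOpen_zariski hUo) hne
  rw [finrank_bandLimited, finrank_euclideanSpace, Fintype.card_fin] at hdim
  obtain ⟨Γ, hΓ, hrange⟩ := exists_contDiff_orbit f π
  have hsub : π '' {f' ∈ U | Φ f' = Φ f} ⊆ Set.range Γ := by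
    rintro _ ⟨f', ⟨hf'U, hf'⟩, rfl⟩
    obtain ⟨g, hg⟩ := hsep f hfU f' hf'U hf'.symm
    exact hrange g f' hg
  by_contra hlt
  -- If the bound fails, then `n > 3`, and the range of `Γ` would be both a neighbourhood of `b` and
  -- a set with dense complement.
  have hfin : Module.finrank ℝ (ℝ × ℝ × ℝ) < Module.finrank ℝ (Fin n → ℝ) := by
    simp only [Module.finrank_prod, Module.finrank_self, Module.finrank_fin_fun]
    omega
  obtain ⟨y, hy, hy'⟩ := (hΓ.dense_compl_range_of_finrank_lt_finrank hfin).inter_nhds_nonempty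
    (Filter.mem_of_superset hnhds hsub)
  exact hy hy'

theorem mainTheorem1 :
    (∀ L : ℕ, Module.finrank ℝ (bandLimited L) = (L + 1) ^ 2) ∧
    (∀ (L k : ℕ) (Φ : bandLimited L → EuclideanSpace ℝ (Fin k)),
      IsCompleteInvariant L k Φ → ((L : ℤ) + 1) ^ 2 - 3 ≤ (k : ℤ)) ∧
    (∃ c : ℝ, 0 < c ∧ ∃ L₀ : ℕ, ∀ L : ℕ, L₀ ≤ L →
      ∀ (k : ℕ) (Φ : bandLimited L → EuclideanSpace ℝ (Fin k)),
        IsCompleteInvariant L k Φ → c * (L : ℝ) ^ 2 ≤ (k : ℝ)) := by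
  -- The constants `c = 1` and `L₀ = 1` work because `(L + 1)² - 3 = L² + 2L - 2 ≥ L²` for `L ≥ 1`.
  refine ⟨finrank_bandLimited, fun L k Φ h => ?_, 1, one_pos, 1, fun L hL k Φ h => ?_⟩
  · have : ((L : ℤ) + 1) ^ 2 ≤ k + 3 := by exact_mod_cast h.sq_le
    linarith
  · have h1 : ((L : ℝ) + 1) ^ 2 ≤ k + 3 := by exact_mod_cast h.sq_le
    have h2 : (1 : ℝ) ≤ L := by exact_mod_cast hL
    nlinarith
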